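/- Let $\Bbbk$ be a field, let $n \in \mathbb{N}$ and $a \in \mathbb{Z}$ with $a \geq -n$, and let $S := \Bbbk[x_0, x_1, \dotsc, x_n]$ be the polynomial ring with its standard grading. Let $V_{n,a} \subset \mathbb{Q}^{\mathbb{N}}$ be the finite-dimensional $\mathbb{Q}$-vector space of all functions $h \colon \mathbb{N} \to \mathbb{Q}$ such that \[ \sum_{j \in \mathbb{N}} h(j)\, t^j = \frac{b_0 + b_1 t + \dotsb + b_{a+n} t^{a+n}}{(1-t)^n} \] for some $b_0, b_1, \dotsc, b_{a+n} \in \mathbb{Q}$, with its usual topology as a finite-dimensional $\mathbb{Q}$-vector space. The Hilbert function of a finitely generated $\mathbb{N}$-graded $S$-module $M = \bigoplus_{j \in \mathbb{N}} M_j$ is $h_M(j) := \dim_{\Bbbk} M_j$. Let $Q_{n,a} \subseteq V_{n,a}$ be the closed convex hull in $V_{n,a}$ of those Hilbert functions of finitely generated $\mathbb{N}$-graded $S$-modules generated in degree zero and having no free summands that belong to $V_{n,a}$, and let $P_{n,a} \subseteq V_{n,a}$ be the closed convex hull in $V_{n,a}$ of $\mathbb{N}^{\mathbb{N}} \cap V_{n,a}$.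 Theorem. If $T \colon \mathbb{Q}^{\mathbb{N}} \to \mathbb{Q}^{\mathbb{N}}$ is the linear operator defined by \[ \bigl(T[h]\bigr)(j) := (n+j+1)\,h(j) - (j+1)\,h(j+1) \qquad (h \colon \mathbb{N} \to \mathbb{Q},\ j \in \mathbb{N}), \] then $T[Q_{n,a}] = P_{n,a}$. -/

import Mathlib

universe u

namespace HilbertCone

/-- The space `V n a` of all `h : ℕ → ℚ` with
`∑ h(j) t^j = (b₀ + b₁ t + ⋯ + b_{a+n} t^{a+n}) / (1 - t)^n` for some rational `bᵢ`. As `1 - t` is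
invertible in `ℚ⟦t⟧`, the fraction is written with its denominator cleared. -/
def V (n : ℕ) (a : ℤ) : Submodule ℚ (ℕ → ℚ) where
  carrier := {h | ∃ b : Polynomial ℚ, (∀ i : ℕ, a + n < i → b.coeff i = 0) ∧
    PowerSeries.mk h * (1 - PowerSeries.X) ^ n = (b : PowerSeries ℚ)}
  zero_mem' := ⟨0, fun _ _ => Polynomial.coeff_zero _, by
    have h0 : PowerSeries.mk (0 : ℕ → ℚ) = 0 := by ext; simp
    rw [h0, zero_mul, Polynomial.coe_zero]⟩
  add_mem' := by
    rintro f g ⟨b, hb, hf⟩ ⟨c, hc, hg⟩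
    refine ⟨b + c, fun i hi => by rw [Polynomial.coeff_add, hb i hi, hc i hi, add_zero], ?_⟩
    have h0 : PowerSeries.mk (f + g) = PowerSeries.mk f + PowerSeries.mk g := by ext; simp
    rw [h0, add_mul, hf, hg, Polynomial.coe_add]
  smul_mem' := by
    rintro c f ⟨b, hb, hf⟩
    refine ⟨Polynomial.C c * b, fun i hi => by rw [Polynomial.coeff_C_mul, hb i hi, mul_zero], ?_⟩
    have h0 : PowerSeries.mk (c • f) = PowerSeries.C c * PowerSeries.mk f := by ext; simp
    rw [h0, mul_assoc, hf, Polynomial.coe_mul, Polynomial.coe_C]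

/-- The linear operator `T[h](j) = (n + j + 1) h(j) - (j + 1) h(j + 1)` on `ℚ^ℕ`. -/
def T (n : ℕ) : (ℕ → ℚ) →ₗ[ℚ] (ℕ → ℚ) where
  toFun h j := ((n : ℚ) + j + 1) * h j - ((j : ℚ) + 1) * h (j + 1)
  map_add' f g := by funext j; simp only [Pi.add_apply]; ring
  map_smul' c f := by
    funext j; simp only [Pi.smul_apply, smul_eq_mul, RingHom.id_apply]; ring

/-- The polynomial ring `S = k[x₀, …, xₙ]`. -/
abbrev S (k : Type u) [Field k] (n : ℕ) : Type u := MvPolynomial (Fin (n + 1)) k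

section Modules

variable {k : Type u} [Field k] {n : ℕ} {M : Type u} [AddCommGroup M] [Module k M]
  [Module (S k n) M]

variable (n) in
/-- `ℳ` is an `ℕ`-grading of the `S`-module `M`: `M` is the internal direct sum of the subspaces
`ℳ j`, and `Sᵢ ℳⱼ ⊆ ℳᵢ₊ⱼ` for the standard grading of `S`. -/
structure IsGrading (ℳ : ℕ → Submodule k M) : Prop where
  isInternal : DirectSum.IsInternal ℳ
  smul_mem : ∀ (i j : ℕ) (p : S k n) (m : M),
    p ∈ MvPolynomial.homogeneousSubmodule (Fin (n + 1)) k i → m ∈ ℳ j → p • m ∈ ℳ (i + j)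

variable (n) in
/-- The graded `S`-module `M` is generated in degree zero. -/
def GeneratedInDegreeZero (ℳ : ℕ → Submodule k M) : Prop :=
  Submodule.span (S k n) (ℳ 0 : Set M) = ⊤

end Modules

/-- `M` has no (nonzero) free direct summand. -/
def NoFreeSummand (R : Type u) [CommRing R] (M : Type u) [AddCommGroup M] [Module R M] : Prop :=
  ∀ F N : Submodule R M, IsCompl F N → Module.Free R F → F = ⊥

/-- The Hilbert function `j ↦ dim_k Mⱼ`. -/
noncomputable def hilbertFunction {k : Type u} [Field k] {M : Type u} [AddCommGroup M] [Module k M]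
    (ℳ : ℕ → Submodule k M) : ℕ → ℕ :=
  fun j => Module.finrank k (ℳ j)

/-- The Hilbert functions of the finitely generated `ℕ`-graded `S`-modules that are generated in
degree zero and have no free summands. -/
def hilbertFunctions (k : Type u) [Field k] (n : ℕ) : Set (ℕ → ℕ) :=
  {h | ∃ (M : Type u) (_ : AddCommGroup M) (_ : Module k M) (_ : Module (S k n) M)
      (_ : IsScalarTower k (S k n) M) (ℳ : ℕ → Submodule k M),
      Module.Finite (S k n) M ∧ IsGrading n ℳ ∧ GeneratedInDegreeZero n ℳ ∧
      NoFreeSummand (S k n) M ∧ h = hilbertFunction ℳ}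

/-- The closed convex hull in `V n a` of the members of `A` that lie in `V n a`, viewed in `ℚ^ℕ`.
The topology of `V n a` is the one induced by the product topology of `ℚ^ℕ`; since `V n a` is
finite-dimensional, it is that of `ℚ^d` under any linear isomorphism with `ℚ^d`. -/
def closedConvexHullIn (n : ℕ) (a : ℤ) (A : Set (ℕ → ℕ)) : Set (ℕ → ℚ) :=
  Subtype.val '' closedConvexHull ℚ {v : V n a | ∃ h ∈ A, ∀ j, (v : ℕ → ℚ) j = (h j : ℚ)}

/-- The cone of Hilbert functions with bounded `a`-invariant. -/
def Q (k : Type u) [Field k] (n : ℕ) (a : ℤ) : Set (ℕ → ℚ) :=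
  closedConvexHullIn n a (hilbertFunctions k n)

/-- The cone of non-negative sequences: the closed convex hull of `ℕ^ℕ ∩ V n a`. -/
def P (n : ℕ) (a : ℤ) : Set (ℕ → ℚ) :=
  closedConvexHullIn n a Set.univ

end HilbertCone

/-!
On generating functions `b / (1 - t)^n`, the operator `T` sends the numerator `b` to
`b - (1 - t) b'`. It is therefore an automorphism of each `V n a`, and a homeomorphism as finitely
many coordinates determine a point of `V n a`. Hence it is enough to show two facts
(`image_closedConvexHullIn`): `T` maps Hilbert functions to sequences of natural numbers, and every
sequence of natural numbers in `V n a` has a positive multiple `T h` with a Hilbert function `h` of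
the required kind.

The first fact says that `dim M_j / dim S_j` does not increase when `M` is generated in degree zero
(`succ_mul_hilbertFunction_le`). Among the products of monomials and generators, those that are not
combinations of smaller ones form bases of the graded pieces, and this set of products is closed
under division by variables. Weighing each division `x_l m ↦ m` by the exponent of `x_l` in `x_l m`
and counting twice gives the inequality (`succ_mul_card_le`).

For the second fact, a sequence of natural numbers with generating function `b / (1 - t)^n` is a sum
of sequences with generating functions `t^i / (1 - t)^m`, where `m ≤ n` (`mk_mem_binomialCone`):
it is eventually monotone, so beyond some point its increments are natural numbers again, and they
have a generating function with one factor `1 - t` less in the denominator. Now `t^i / (1 - t)^m` is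
up to a positive factor the image under `T` of the Hilbert function of `S / (x_0, …, x_{n-m})^{i+1}`
(`exists_T_eq_smul_X_pow_mul`), because `T` telescopes the generating function of this module. Direct
sums realize the sums, and all these modules are torsion, hence have no free summands. That a Hilbert
function `h` obtained in this way lies in `V n a` can be read off from `T h` (`mem_V_of_T_mem_V`),
although the summands need not have their Hilbert functions in `V n a`. No limits are needed.
-/

namespace HilbertCone

/-! ### The operator on generating functions -/

section Operator

open PowerSeries

/-- On generating functions `H`, the operator `T` is `H ↦ (n + 1) H - (1 - t) H'`. -/
theorem mk_T (n : ℕ) (h : ℕ → ℚ) :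
    mk (T n h) = ((n : ℚ⟦X⟧) + 1) * mk h - (1 - X) * d⁄dX ℚ (mk h) := by
  ext j
  rw [sub_mul, one_mul, map_sub, map_sub]
  have h1 : ((n : ℚ⟦X⟧) + 1) * mk h = C ((n : ℚ) + 1) * mk h := by simp
  rw [h1, coeff_C_mul, coeff_derivative, coeff_mk, coeff_mk, coeff_mk]
  rcases j with _ | j
  · simp [T]
  · rw [coeff_succ_X_mul, coeff_derivative, coeff_mk]
    simp only [T, LinearMap.coe_mk, AddHom.coe_mk]
    push_cast
    ring

/-- On numerators `b` of fractions `b / (1 - t)^n`, the operator `T` is `b ↦ b - (1 - t) b'`. -/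
theorem mk_T_mul_pow {n : ℕ} {h : ℕ → ℚ} {b : Polynomial ℚ}
    (hb : mk h * (1 - X) ^ n = (b : ℚ⟦X⟧)) :
    mk (T n h) * (1 - X) ^ n =
      ((b - (1 - Polynomial.X) * Polynomial.derivative b : Polynomial ℚ) : ℚ⟦X⟧) := by
  have hd := congrArg (d⁄dX ℚ) hb
  rw [derivative_coe, Derivation.leibniz, derivative_pow] at hd
  simp only [map_sub, derivative_X, derivative_one, smul_eq_mul] at hd
  rw [mk_T]
  simp only [Polynomial.coe_sub, Polynomial.coe_mul, Polynomial.coe_one, Polynomial.coe_X]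
  rw [← hd, ← hb]
  rcases n with _ | n
  · simp
  · simp; ring

theorem coeff_sub_one_sub_X_mul_derivative (b : Polynomial ℚ) (i : ℕ) :
    (b - (1 - Polynomial.X) * Polynomial.derivative b).coeff i =
      ((i : ℚ) + 1) * (b.coeff i - b.coeff (i + 1)) := by
  rw [sub_mul, one_mul, Polynomial.coeff_sub, Polynomial.coeff_sub, Polynomial.coeff_derivative]
  rcases i with _ | i
  · simp
  · rw [Polynomial.coeff_X_mul, Polynomial.coeff_derivative]
    push_cast
    ring

theorem T_mem_V {n : ℕ} {a : ℤ} {h : ℕ → ℚ} (hh : h ∈ V n a) : T n h ∈ V n a := by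
  obtain ⟨b, hb, hh⟩ := hh
  refine ⟨_, fun i hi => ?_, mk_T_mul_pow hh⟩
  rw [coeff_sub_one_sub_X_mul_derivative, hb i hi, hb (i + 1) (by push_cast; lia)]
  simp

/-- Applying `T` does not lower the degree of the numerator: a function with generating function
`b / (1 - t)^n` lies in `V n a` as soon as its image does. For `i > a + n` the coefficients of `b` at
`i` and `i + 1` agree, and they are eventually zero. -/
theorem mem_V_of_T_mem_V {n : ℕ} {a : ℤ} {h : ℕ → ℚ} {b : Polynomial ℚ}
    (hb : mk h * (1 - X) ^ n = (b : ℚ⟦X⟧)) (hT : T n h ∈ V n a) : h ∈ V n a := by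
  obtain ⟨c, hc, hhc⟩ := hT
  rw [mk_T_mul_pow hb] at hhc
  have hbc := Polynomial.coe_injective ℚ hhc
  have step : ∀ i : ℕ, a + n < i → b.coeff i = b.coeff (i + 1) := fun i hi => by
    have h1 := coeff_sub_one_sub_X_mul_derivative b i
    rw [hbc, hc i hi] at h1
    have h2 : (i : ℚ) + 1 ≠ 0 := by positivity
    have := (mul_eq_zero.1 h1.symm).resolve_left h2
    linarith
  refine ⟨b, fun i hi => ?_, hb⟩
  have const : ∀ l : ℕ, b.coeff i = b.coeff (i + l) := fun l => by
    induction l with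
    | zero => rfl
    | succ l ih => rw [ih, step (i + l) (by push_cast; lia), add_assoc]
  rw [const (b.natDegree + 1)]
  exact Polynomial.coeff_eq_zero_of_natDegree_lt (by lia)

theorem one_sub_X_pow_ne_zero (n : ℕ) : (1 - X : ℚ⟦X⟧) ^ n ≠ 0 := by
  refine pow_ne_zero _ fun h => ?_
  have := congrArg (coeff 0) h
  simp at this

theorem eq_zero_of_mk_mul {n : ℕ} {h : ℕ → ℚ} (hh : mk h * (1 - X) ^ n = 0) : h = 0 := by
  have := (mul_eq_zero.1 hh).resolve_right (one_sub_X_pow_ne_zero n)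
  funext j
  simpa using congrArg (coeff j) this

theorem eq_zero_of_T_eq_zero {n : ℕ} {a : ℤ} {h : ℕ → ℚ} (hh : h ∈ V n a) (hT : T n h = 0) :
    h = 0 := by
  obtain ⟨b, -, hb⟩ := hh
  -- `T h` lies in every `V n a'`, in particular in `V n (-n - 1) = 0`.
  have h0 : T n h ∈ V n (-(n : ℤ) - 1) := hT ▸ zero_mem _
  obtain ⟨c, hc, hhc⟩ := mem_V_of_T_mem_V hb h0
  have : c = 0 := by
    ext i
    simpa using hc i (by lia)
  exact eq_zero_of_mk_mul (by rw [hhc, this, Polynomial.coe_zero])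

/-- A function in `V n a` that vanishes at `0, …, a + n` is zero. -/
theorem eq_zero_of_mem_V_of_forall_le {n : ℕ} {a : ℤ} {h : ℕ → ℚ} (hh : h ∈ V n a)
    (h0 : ∀ j : ℕ, (j : ℤ) ≤ a + n → h j = 0) : h = 0 := by
  obtain ⟨b, hb, hhb⟩ := hh
  have : b = 0 := by
    ext i
    rw [Polynomial.coeff_zero]
    rcases lt_or_ge (a + n) (i : ℤ) with hi | hi
    · exact hb i hi
    · rw [← Polynomial.coeff_coe, ← hhb, coeff_mul]
      refine Finset.sum_eq_zero fun p hp => ?_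
      rw [Finset.HasAntidiagonal.mem_antidiagonal] at hp
      rw [coeff_mk, h0 p.1 (by lia), zero_mul]
  exact eq_zero_of_mk_mul (by rw [hhb, this, Polynomial.coe_zero])

end Operator

/-! ### Sequences of natural numbers with a rational generating function -/

section BinomialCone

open PowerSeries

/-- The polynomials, as a subring of the ring of power series. -/
noncomputable abbrev polynomialSubring : Subring ℚ⟦X⟧ :=
  (Polynomial.coeToPowerSeries.ringHom (R := ℚ)).range

theorem mem_polynomialSubring {F : ℚ⟦X⟧} :
    F ∈ polynomialSubring ↔ ∃ b : Polynomial ℚ, F = (b : ℚ⟦X⟧) := by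
  simp [polynomialSubring, RingHom.mem_range, eq_comm]

theorem X_mem_polynomialSubring : (X : ℚ⟦X⟧) ∈ polynomialSubring :=
  mem_polynomialSubring.2 ⟨Polynomial.X, by simp⟩

theorem eventually_coeff_eq_zero {F : ℚ⟦X⟧} (hF : F ∈ polynomialSubring) :
    ∃ N, ∀ j, N ≤ j → coeff j F = 0 := by
  obtain ⟨b, rfl⟩ := mem_polynomialSubring.1 hF
  refine ⟨b.natDegree + 1, fun j hj => ?_⟩
  rw [Polynomial.coeff_coe]
  exact Polynomial.coeff_eq_zero_of_natDegree_lt hj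

theorem coeff_succ_mul_one_sub_X (F : ℚ⟦X⟧) (j : ℕ) :
    coeff (j + 1) (F * (1 - X)) = coeff (j + 1) F - coeff j F := by
  rw [mul_sub, mul_one, map_sub, coeff_succ_mul_X]

/-- The coefficients of a rational function `b / (1 - t)^n` have constant sign eventually. -/
theorem eventually_nonneg_or_nonpos (n : ℕ) (F : ℚ⟦X⟧) (hF : F * (1 - X) ^ n ∈ polynomialSubring) :
    ∃ N, (∀ j, N ≤ j → 0 ≤ coeff j F) ∨ (∀ j, N ≤ j → coeff j F ≤ 0) := by
  induction n generalizing F with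
  | zero =>
    obtain ⟨N, hN⟩ := eventually_coeff_eq_zero (by simpa using hF)
    exact ⟨N, Or.inl fun j hj => (hN j hj).ge⟩
  | succ n ih =>
    rw [pow_succ', ← mul_assoc] at hF
    obtain ⟨N, hN | hN⟩ := ih _ hF
    · -- The coefficients increase from `N` on.
      have mono : ∀ i j, N ≤ i → i ≤ j → coeff i F ≤ coeff j F := fun i j hi hij => by
        induction j, hij using Nat.le_induction with
        | base => rfl
        | succ j hj ih' =>
          have := hN (j + 1) (by lia)
          rw [coeff_succ_mul_one_sub_X] at this
          linarith
      by_cases h : ∃ M, N ≤ M ∧ 0 ≤ coeff M F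
      · obtain ⟨M, hM, h⟩ := h
        exact ⟨M, Or.inl fun j hj => h.trans (mono M j hM hj)⟩
      · push Not at h
        exact ⟨N, Or.inr fun j hj => (h j hj).le⟩
    · have mono : ∀ i j, N ≤ i → i ≤ j → coeff j F ≤ coeff i F := fun i j hi hij => by
        induction j, hij using Nat.le_induction with
        | base => rfl
        | succ j hj ih' =>
          have := hN (j + 1) (by lia)
          rw [coeff_succ_mul_one_sub_X] at this
          linarith
      by_cases h : ∃ M, N ≤ M ∧ coeff M F ≤ 0
      · obtain ⟨M, hM, h⟩ := h
        exact ⟨M, Or.inr fun j hj => (mono M j hM hj).trans h⟩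
      · push Not at h
        exact ⟨N, Or.inl fun j hj => (h j hj).le⟩

/-- The sums, with repetitions, of the series `t^i / (1 - t)^m` with `m ≤ n`. -/
def binomialCone (n : ℕ) : AddSubmonoid ℚ⟦X⟧ :=
  AddSubmonoid.closure {F | ∃ i m : ℕ, m ≤ n ∧ F = X ^ i * mk 1 ^ m}

theorem X_pow_mul_mem_binomialCone (i : ℕ) {m n : ℕ} (hmn : m ≤ n) :
    X ^ i * mk 1 ^ m ∈ binomialCone n :=
  AddSubmonoid.subset_closure ⟨i, m, hmn, rfl⟩

theorem mul_mk_one_mem_binomialCone {n : ℕ} {F : ℚ⟦X⟧} (hF : F ∈ binomialCone n) :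
    F * mk 1 ∈ binomialCone (n + 1) := by
  induction hF using AddSubmonoid.closure_induction with
  | mem F hF =>
    obtain ⟨i, m, hm, rfl⟩ := hF
    rw [mul_assoc, ← pow_succ]
    exact X_pow_mul_mem_binomialCone i (by lia)
  | zero => simp
  | add F G _ _ hF hG => rw [add_mul]; exact add_mem hF hG

theorem polynomial_mem_binomialCone (n N : ℕ) (g : ℕ → ℕ) :
    ∑ j ∈ Finset.range N, g j • (X : ℚ⟦X⟧) ^ j ∈ binomialCone n := by
  refine sum_mem fun j _ => nsmul_mem ?_ _
  simpa using X_pow_mul_mem_binomialCone j (Nat.zero_le n)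

theorem coeff_sum_smul_X_pow (N : ℕ) (g : ℕ → ℕ) (j : ℕ) :
    coeff j (∑ i ∈ Finset.range N, g i • (X : ℚ⟦X⟧) ^ i) = if j < N then (g j : ℚ) else 0 := by
  simp only [map_sum, map_nsmul, coeff_X_pow]
  simp

/-- A sequence of natural numbers whose generating function is `b / (1 - t)^n` becomes monotone. -/
theorem eventually_monotone {n : ℕ} {g : ℕ → ℕ}
    (hg : mk (fun j => (g j : ℚ)) * (1 - X) ^ (n + 1) ∈ polynomialSubring) :
    ∃ N, ∀ j, N ≤ j → g j ≤ g (j + 1) := by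
  rw [pow_succ', ← mul_assoc] at hg
  obtain ⟨N, hN | hN⟩ := eventually_nonneg_or_nonpos n _ hg
  · refine ⟨N, fun j hj => ?_⟩
    have := hN (j + 1) (by lia)
    rw [coeff_succ_mul_one_sub_X, coeff_mk, coeff_mk] at this
    exact_mod_cast sub_nonneg.1 this
  · -- A decreasing sequence of natural numbers is eventually constant.
    have anti : Antitone fun j => g (N + j) := antitone_nat_of_succ_le fun j => by
      have := hN (N + j + 1) (by lia)
      rw [coeff_succ_mul_one_sub_X, coeff_mk, coeff_mk] at this
      exact_mod_cast sub_nonpos.1 this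
    refine ⟨N + Function.argmin fun j => g (N + j), fun j hj => ?_⟩
    have h1 := anti (show Function.argmin (fun j => g (N + j)) ≤ j - N by lia)
    have h2 := Function.argmin_le (fun j => g (N + j)) (j + 1 - N)
    simp only [show N + (j - N) = j by lia, show N + (j + 1 - N) = j + 1 by lia] at h1 h2
    exact h1.trans h2

/-- Sequences of natural numbers with a rational generating function `b / (1 - t)^n` are sums of the
sequences with generating functions `t^i / (1 - t)^m`, `m ≤ n`. -/
theorem mk_mem_binomialCone (n : ℕ) (g : ℕ → ℕ)
    (hg : mk (fun j => (g j : ℚ)) * (1 - X) ^ n ∈ polynomialSubring) :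
    mk (fun j => (g j : ℚ)) ∈ binomialCone n := by
  induction n generalizing g with
  | zero =>
    obtain ⟨N, hN⟩ := eventually_coeff_eq_zero (by simpa using hg)
    convert polynomial_mem_binomialCone 0 N g using 1
    ext j
    rw [coeff_sum_smul_X_pow, coeff_mk]
    split_ifs with hj
    · rfl
    · simpa using hN j (by lia)
  | succ n ih =>
    obtain ⟨N, hN⟩ := eventually_monotone hg
    -- the increments of `g` beyond `N`
    let δ : ℕ → ℕ := fun j => if N < j then g j - g (j - 1) else 0
    -- `p` is the part of `g` below `N`; beyond `N`, the sequence is recovered from `g N` and the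
    -- increments, all of which are natural numbers.
    set p : ℚ⟦X⟧ := ∑ j ∈ Finset.range N, g j • (X : ℚ⟦X⟧) ^ j with hp
    have key : mk (fun j => (g j : ℚ)) * (1 - X) =
        p * (1 - X) + g N • X ^ N + mk (fun j => (δ j : ℚ)) := by
      ext j
      rcases j with _ | j
      · rcases N with _ | N
        · simp [hp, δ]
        · rw [map_add, map_add, mul_sub, mul_sub, mul_one, mul_one, map_sub, map_sub, hp,
            coeff_sum_smul_X_pow, map_nsmul, coeff_X_pow]
          simp [δ]
      · rw [coeff_succ_mul_one_sub_X, map_add, map_add, coeff_succ_mul_one_sub_X,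
          coeff_sum_smul_X_pow, coeff_sum_smul_X_pow, map_nsmul, coeff_X_pow, coeff_mk, coeff_mk,
          coeff_mk]
        rcases lt_trichotomy (j + 1) N with h | h | h
        · simp [δ, h, h.ne, (show ¬ N < j + 1 by lia), (show j < N by lia)]
        · simp [δ, ← h]
          ring
        · simp only [δ, h, if_pos, if_neg (show ¬ j + 1 < N by lia), if_neg h.ne',
            if_neg (show ¬ j < N by lia), Nat.add_sub_cancel]
          rw [Nat.cast_sub (hN j (by lia))]
          simp
    have one : (mk 1 : ℚ⟦X⟧) * (1 - X) = 1 := mk_one_mul_one_sub_eq_one ℚ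
    have hp' : p ∈ polynomialSubring :=
      sum_mem fun j _ => nsmul_mem (pow_mem X_mem_polynomialSubring _) _
    have h1X : (1 - X : ℚ⟦X⟧) ∈ polynomialSubring := sub_mem (one_mem _) X_mem_polynomialSubring
    have hδ : mk (fun j => (δ j : ℚ)) * (1 - X) ^ n ∈ polynomialSubring := by
      have : mk (fun j => (δ j : ℚ)) * (1 - X) ^ n =
          mk (fun j => (g j : ℚ)) * (1 - X) ^ (n + 1) - p * (1 - X) ^ (n + 1)
            - (g N • X ^ N) * (1 - X) ^ n := by
        rw [pow_succ']
        linear_combination (-(1 - X) ^ n) * key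
      rw [this]
      exact sub_mem (sub_mem hg (mul_mem hp' (pow_mem h1X _)))
        (mul_mem (nsmul_mem (pow_mem X_mem_polynomialSubring _) _) (pow_mem h1X _))
    have : mk (fun j => (g j : ℚ)) =
        p + g N • (X ^ N * mk 1 ^ 1) + mk (fun j => (δ j : ℚ)) * mk 1 := by
      rw [nsmul_eq_mul] at key ⊢
      linear_combination mk 1 * key - (mk (fun j => (g j : ℚ)) - p) * one
    rw [this]
    exact add_mem (add_mem (polynomial_mem_binomialCone _ _ _)
      (nsmul_mem (X_pow_mul_mem_binomialCone _ (by lia)) _))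
      (mul_mk_one_mem_binomialCone (ih δ hδ))

end BinomialCone

/-! ### Topology of the space of functions -/

section Topology

/-- The values at `0, …, a + n`, which determine a member of `V n a`. -/
def initialValues (n : ℕ) (a : ℤ) : V n a →ₗ[ℚ] (Fin (a + n + 1).toNat → ℚ) :=
  LinearMap.pi fun i => (LinearMap.proj (i : ℕ)).comp (V n a).subtype

theorem ker_initialValues (n : ℕ) (a : ℤ) : LinearMap.ker (initialValues n a) = ⊥ := by
  refine LinearMap.ker_eq_bot'.2 fun v hv => Subtype.ext ?_
  refine eq_zero_of_mem_V_of_forall_le v.2 fun j hj => ?_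
  exact congrFun hv ⟨j, by lia⟩

instance (n : ℕ) (a : ℤ) : FiniteDimensional ℚ (V n a) :=
  Module.Finite.of_injective _ (LinearMap.ker_eq_bot.1 (ker_initialValues n a))

/-- As `ℚ` is not complete, continuity of linear maps on `V n a` is not automatic. It holds because
finitely many coordinates of `ℚ^ℕ` determine a point of `V n a`. -/
theorem continuous_linearMap {n : ℕ} {a : ℤ} (φ : V n a →ₗ[ℚ] (ℕ → ℚ)) : Continuous φ := by
  obtain ⟨L, hL⟩ := LinearMap.exists_leftInverse_of_injective _ (ker_initialValues n a)
  have h1 : Continuous (initialValues n a) :=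
    continuous_pi fun i => (continuous_apply (i : ℕ)).comp continuous_subtype_val
  have h2 : (φ : V n a → ℕ → ℚ) = (φ ∘ₗ L) ∘ initialValues n a := by
    funext v
    exact congrArg φ (LinearMap.congr_fun hL v).symm
  rw [h2]
  exact (LinearMap.continuous_on_pi _).comp h1

/-- `T` as an automorphism of `V n a`. -/
noncomputable def equivV (n : ℕ) (a : ℤ) : V n a ≃ₗ[ℚ] V n a :=
  LinearEquiv.ofInjectiveEndo ((T n).restrict fun _ h => T_mem_V h) <|
    LinearMap.ker_eq_bot.1 <| LinearMap.ker_eq_bot'.2 fun v hv =>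
      Subtype.ext (eq_zero_of_T_eq_zero v.2 (congrArg Subtype.val hv))

theorem coe_equivV {n : ℕ} {a : ℤ} (v : V n a) : (equivV n a v : ℕ → ℚ) = T n v := rfl

theorem continuous_linearEquiv {n : ℕ} {a : ℤ} (φ : V n a ≃ₗ[ℚ] V n a) : Continuous φ :=
  continuous_induced_rng.2 (continuous_linearMap ((V n a).subtype ∘ₗ φ.toLinearMap))

/-- A linear automorphism maps closed convex hulls into closed convex hulls. -/
theorem closedConvexHull_subset_preimage {n : ℕ} {a : ℤ} (φ : V n a ≃ₗ[ℚ] V n a)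
    {X Y : Set (V n a)} (h : ∀ x ∈ X, φ x ∈ closedConvexHull ℚ Y) :
    closedConvexHull ℚ X ⊆ φ ⁻¹' closedConvexHull ℚ Y :=
  closedConvexHull_min h (convex_closedConvexHull.linear_preimage φ.toLinearMap)
    (isClosed_closedConvexHull.preimage (continuous_linearEquiv φ))

/-- If `T` maps the members of `A` to sequences of natural numbers, and each sequence of natural
numbers in `V n a` has a positive multiple that is the image of a member of `A`, then `T` maps the
closed convex hull of `A` onto that of all sequences of natural numbers. -/
theorem image_closedConvexHullIn {n : ℕ} {a : ℤ} {A : Set (ℕ → ℕ)} (h0 : 0 ∈ A)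
    (hA : ∀ h ∈ A, ∃ g : ℕ → ℕ, T n (fun j => (h j : ℚ)) = fun j => (g j : ℚ))
    (hT : ∀ g : ℕ → ℕ, (fun j => (g j : ℚ)) ∈ V n a → ∃ h ∈ A, ∃ N : ℕ, 0 < N ∧
      (fun j => (h j : ℚ)) ∈ V n a ∧ T n (fun j => (h j : ℚ)) = N • fun j => (g j : ℚ)) :
    T n '' closedConvexHullIn n a A = closedConvexHullIn n a Set.univ := by
  apply Set.Subset.antisymm
  · rintro _ ⟨_, ⟨v, hv, rfl⟩, rfl⟩
    refine ⟨equivV n a v, closedConvexHull_subset_preimage _ (fun x hx => ?_) hv, coe_equivV v⟩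
    obtain ⟨h, hh, hx⟩ := hx
    obtain ⟨g, hg⟩ := hA h hh
    refine subset_closedConvexHull ⟨g, trivial, fun j => ?_⟩
    rw [coe_equivV, funext hx, hg]
  · rintro _ ⟨v, hv, rfl⟩
    refine ⟨(equivV n a).symm v, ⟨_, closedConvexHull_subset_preimage (equivV n a).symm
      (fun x hx => ?_) hv, rfl⟩, by rw [← coe_equivV, LinearEquiv.apply_symm_apply]⟩
    obtain ⟨g, -, hg⟩ := hx
    have hg : (x : ℕ → ℚ) = fun j => (g j : ℚ) := funext hg
    obtain ⟨h, hh, N, hN, hV, hTh⟩ := hT g (hg ▸ x.2)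
    have hN' : (N : ℚ) ≠ 0 := by positivity
    let w : V n a := ⟨_, hV⟩
    -- The preimage of `x` is `h / N`, a point of the segment from `0` to `h`.
    have hw : (equivV n a).symm x = (N : ℚ)⁻¹ • w := by
      rw [LinearEquiv.symm_apply_eq, map_smul, eq_inv_smul_iff₀ hN']
      refine Subtype.ext ?_
      rw [coe_equivV, hTh, Submodule.coe_smul, hg, Nat.cast_smul_eq_nsmul]
    rw [hw]
    let Y : Set (V n a) := {v | ∃ h ∈ A, ∀ j, (v : ℕ → ℚ) j = (h j : ℚ)}
    have hw1 : w ∈ closedConvexHull ℚ Y := subset_closedConvexHull ⟨h, hh, fun j => rfl⟩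
    have hw0 : (0 : V n a) ∈ closedConvexHull ℚ Y := subset_closedConvexHull ⟨0, h0, fun j => by simp⟩
    exact convex_closedConvexHull.smul_mem_of_zero_mem hw0 hw1
      ⟨by positivity, inv_le_one_of_one_le₀ (by exact_mod_cast hN)⟩

end Topology

/-! ### Growth of Hilbert functions -/

section GrowthBound

open Finset

section Greedy

variable {K W ι L : Type*} [Field K] [AddCommGroup W] [Module K W] [LinearOrder L]

open Classical in
/-- The indices of the vectors that are not combinations of vectors with smaller index, where `κ`
orders the indices. -/
noncomputable def greedyBasis (K : Type*) {W ι L : Type*} [Field K] [AddCommGroup W] [Module K W]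
    [LinearOrder L] (κ : ι → L) (v : ι → W) (s : Finset ι) : Finset ι :=
  {i ∈ s | v i ∉ Submodule.span K (v '' {j | j ∈ s ∧ κ j < κ i})}

theorem mem_greedyBasis {κ : ι → L} {v : ι → W} {s : Finset ι} {i : ι} :
    i ∈ greedyBasis K κ v s ↔
      i ∈ s ∧ v i ∉ Submodule.span K (v '' {j | j ∈ s ∧ κ j < κ i}) := by
  simp [greedyBasis]

/-- The vectors at the indices of `greedyBasis` form a basis of the span of all vectors. -/
theorem linearIndepOn_greedyBasis_and_span {κ : ι → L} (hκ : Function.Injective κ) (v : ι → W)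
    (s : Finset ι) :
    LinearIndepOn K v (greedyBasis K κ v s : Set ι) ∧
      Submodule.span K (v '' (greedyBasis K κ v s : Set ι)) = Submodule.span K (v '' (s : Set ι)) := by
  classical
  induction s using Finset.induction_on_max_value κ with
  | empty => simp [greedyBasis]
  | insert a s ha hmax ih =>
    have hlt : ∀ x ∈ s, κ x < κ a := fun x hx =>
      (hmax x hx).lt_of_ne fun h => ha (hκ h ▸ hx)
    have hs : ∀ i ∈ s, {j | j ∈ insert a s ∧ κ j < κ i} = {j | j ∈ s ∧ κ j < κ i} := by
      intro i hi
      ext j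
      simp only [Set.mem_ofPred_eq, mem_insert]
      refine ⟨fun ⟨h, hj⟩ => ⟨h.resolve_left ?_, hj⟩, fun ⟨h, hj⟩ => ⟨Or.inr h, hj⟩⟩
      rintro rfl
      exact (hlt i hi).not_gt hj
    have has : {j | j ∈ insert a s ∧ κ j < κ a} = (s : Set ι) := by
      ext j
      simp only [Set.mem_ofPred_eq, mem_insert, mem_coe]
      refine ⟨fun ⟨h, hj⟩ => h.resolve_left ?_, fun h => ⟨Or.inr h, hlt j h⟩⟩
      rintro rfl
      exact hj.false
    by_cases hv : v a ∈ Submodule.span K (v '' (s : Set ι))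
    · have : greedyBasis K κ v (insert a s) = greedyBasis K κ v s := by
        ext i
        simp only [mem_greedyBasis, mem_insert]
        constructor
        · rintro ⟨rfl | hi, h⟩
          · simp only [← mem_insert, has] at h
            exact absurd hv h
          · simp only [← mem_insert, hs i hi] at h
            exact ⟨hi, h⟩
        · rintro ⟨hi, h⟩
          refine ⟨Or.inr hi, ?_⟩
          simp only [← mem_insert, hs i hi]
          exact h
      rw [this, coe_insert, Set.image_insert_eq, Submodule.span_insert_eq_span hv]
      exact ih
    · have : greedyBasis K κ v (insert a s) = insert a (greedyBasis K κ v s) := by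
        ext i
        simp only [mem_greedyBasis, mem_insert]
        constructor
        · rintro ⟨rfl | hi, h⟩
          · exact Or.inl rfl
          · simp only [← mem_insert, hs i hi] at h
            exact Or.inr ⟨hi, h⟩
        · rintro (rfl | ⟨hi, h⟩)
          · refine ⟨Or.inl rfl, ?_⟩
            simp only [← mem_insert, has]
            exact hv
          · refine ⟨Or.inr hi, ?_⟩
            simp only [← mem_insert, hs i hi]
            exact h
      rw [this, coe_insert, coe_insert, Set.image_insert_eq, Set.image_insert_eq,
        Submodule.span_insert, ih.2, ← Submodule.span_insert]
      exact ⟨ih.1.insert (by rwa [ih.2]), rfl⟩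

theorem finrank_span_eq_card_greedyBasis {κ : ι → L} (hκ : Function.Injective κ) (v : ι → W)
    (s : Finset ι) :
    Module.finrank K (Submodule.span K (v '' (s : Set ι))) = #(greedyBasis K κ v s) := by
  obtain ⟨h1, h2⟩ := linearIndepOn_greedyBasis_and_span (K := K) hκ v s
  rw [← h2, Set.image_eq_range]
  exact (finrank_span_eq_card h1).trans (by simp)

end Greedy

/-- Let `B'` be a set of monomials of degree `j + 1` in several copies of a polynomial ring, such
that all quotients of its members by variables are in the set `B` of monomials of degree `j`. Give
the pair `(m, x_l m)` the weight of the exponent of `x_l` in `x_l m`. Then the pairs with a given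
larger monomial weigh `j + 1` together, those with a given smaller monomial
at most `j + N`, where `N` is the number of variables. -/
theorem succ_mul_card_le {ι σ : Type*} [Fintype σ] {j N : ℕ} (hN : Fintype.card σ = N)
    {B B' : Finset (ι × (σ →₀ ℕ))}
    (hB : ∀ b ∈ B, b.2.degree = j) (hB' : ∀ b ∈ B', b.2.degree = j + 1)
    (hBB' : ∀ i m l, (i, m + Finsupp.single l 1) ∈ B' → (i, m) ∈ B) :
    (j + 1) * #B' ≤ (j + N) * #B := by
  classical
  have h1 : (j + 1) * #B' = ∑ l : σ, ∑ b ∈ B', b.2 l := by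
    rw [sum_comm, mul_comm, ← smul_eq_mul, ← sum_const]
    exact sum_congr rfl fun b hb => by rw [← hB' b hb, Finsupp.degree_eq_sum]
  have h2 : (j + N) * #B = ∑ l : σ, ∑ b ∈ B, (b.2 l + 1) := by
    rw [sum_comm, mul_comm, ← smul_eq_mul, ← sum_const]
    refine sum_congr rfl fun b hb => ?_
    rw [sum_add_distrib, ← Finsupp.degree_eq_sum, hB b hb]
    simp [hN]
  rw [h1, h2]
  refine sum_le_sum fun l _ => ?_
  let f : ι × (σ →₀ ℕ) → ι × (σ →₀ ℕ) := fun b => (b.1, b.2 + Finsupp.single l 1)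
  have hf : Function.Injective f := fun b c h => by
    simp only [f, Prod.mk.injEq, add_left_inj] at h
    exact Prod.ext h.1 h.2
  calc ∑ b ∈ B', b.2 l ≤ ∑ b ∈ B.image f, b.2 l := by
        rw [← sum_filter_ne_zero]
        refine sum_le_sum_of_subset fun b hb => ?_
        obtain ⟨hb, hl⟩ := mem_filter.1 hb
        have hsub : b.2 - Finsupp.single l 1 + Finsupp.single l 1 = b.2 := by
          refine tsub_add_cancel_of_le (Finsupp.single_le_iff.2 ?_)
          lia
        refine mem_image.2 ⟨(b.1, b.2 - Finsupp.single l 1), hBB' _ _ l ?_, ?_⟩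
        · rw [hsub]; exact hb
        · simp only [f, hsub]
    _ = ∑ b ∈ B, (b.2 l + 1) := by
        rw [sum_image hf.injOn]
        simp [f]

/-- Subspaces of the components of a direct sum that jointly span are the whole components. -/
theorem eq_of_le_of_iSup_eq_top {K W ι : Type*} [Ring K] [AddCommGroup W] [Module K W]
    {p q : ι → Submodule K W} (hq : iSupIndep q) (hpq : ∀ i, p i ≤ q i) (hp : ⨆ i, p i = ⊤)
    (i : ι) : p i = q i := by
  have h1 : p i ⊔ ⨆ j ≠ i, p j = ⊤ := by
    refine top_unique (hp ▸ iSup_le fun l => ?_)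
    by_cases h : l = i
    · exact h ▸ le_sup_left
    · exact (le_iSup₂ (f := fun l (_ : l ≠ i) => p l) l h).trans le_sup_right
  have h2 : Disjoint (q i) (⨆ j ≠ i, p j) := (hq i).mono_right (iSup₂_mono fun l _ => hpq l)
  calc p i = p i ⊔ (⨆ j ≠ i, p j) ⊓ q i := by rw [h2.symm.eq_bot, sup_bot_eq]
    _ = (p i ⊔ ⨆ j ≠ i, p j) ⊓ q i := (sup_inf_assoc_of_le _ (hpq i)).symm
    _ = q i := by rw [h1, top_inf_eq]

section Growth

variable {k : Type u} [Field k] {n : ℕ} {M : Type u} [AddCommGroup M] [Module k M]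
  [Module (S k n) M] {ℳ : ℕ → Submodule k M}

theorem exists_generators_mem_zero (hfin : Module.Finite (S k n) M)
    (hgen : GeneratedInDegreeZero n ℳ) :
    ∃ (r : ℕ) (g : Fin r → M), (∀ i, g i ∈ ℳ 0) ∧
      Submodule.span (S k n) (Set.range g) = ⊤ := by
  have h : (Submodule.span (S k n) (ℳ 0 : Set M)).FG := by
    rw [show Submodule.span (S k n) (ℳ 0 : Set M) = ⊤ from hgen]
    exact hfin.fg_top
  obtain ⟨t, ht, hs⟩ := (Submodule.fg_span_iff_fg_span_finset_subset _).1 h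
  refine ⟨#t, fun i => t.equivFin.symm i, fun i => ht (t.equivFin.symm i).2, ?_⟩
  have : Set.range (fun i => (t.equivFin.symm i : M)) = t := by
    rw [Set.range_comp' Subtype.val, t.equivFin.symm.surjective.range_eq]
    simp
  rw [this, ← hs]
  exact hgen

/-- The multiples of generators `g i` by monomials, indexed by the pairs of a generator and a
monomial. -/
noncomputable def monomialMultiple (k : Type u) [Field k] {n : ℕ} {M : Type u} [AddCommGroup M]
    [Module (S k n) M] {r : ℕ} (g : Fin r → M) (p : Fin r × (Fin (n + 1) →₀ ℕ)) : M :=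
  (MvPolynomial.monomial p.2 (1 : k) : S k n) • g p.1

variable [IsScalarTower k (S k n) M]

theorem span_monomialMultiple (hℳ : IsGrading n ℳ) {r : ℕ} {g : Fin r → M}
    (hg : ∀ i, g i ∈ ℳ 0) (hspan : Submodule.span (S k n) (Set.range g) = ⊤) (j : ℕ) :
    Submodule.span k
      (monomialMultiple k g '' {p : Fin r × (Fin (n + 1) →₀ ℕ) | p.2.degree = j}) = ℳ j := by
  refine eq_of_le_of_iSup_eq_top (p := fun j =>
    Submodule.span k (monomialMultiple k g '' {p : Fin r × (Fin (n + 1) →₀ ℕ) | p.2.degree = j}))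
    hℳ.isInternal.submodule_iSupIndep (fun j => ?_) ?_ j
  · rw [Submodule.span_le]
    rintro _ ⟨p, rfl, rfl⟩
    exact hℳ.smul_mem _ 0 _ _ (MvPolynomial.isHomogeneous_monomial _ rfl) (hg p.1)
  · rw [← Submodule.span_iUnion, ← Set.image_iUnion]
    rw [eq_top_iff]
    rintro x -
    have hx : x ∈ Submodule.span (S k n) (Set.range g) := hspan ▸ trivial
    induction hx using Submodule.span_induction with
    | mem x hx =>
      obtain ⟨i, rfl⟩ := hx
      refine Submodule.subset_span ⟨(i, 0), by simp, ?_⟩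
      simp [monomialMultiple]
    | zero => exact zero_mem _
    | add x y _ _ hx hy => exact add_mem hx hy
    | smul c x hxS hx =>
      rw [c.as_sum, Finset.sum_smul]
      refine sum_mem fun m _ => ?_
      have hm : MvPolynomial.monomial m (c.coeff m) =
          c.coeff m • (MvPolynomial.monomial m 1 : S k n) := by
        rw [MvPolynomial.smul_monomial, smul_eq_mul, mul_one]
      rw [hm, smul_assoc]
      refine Submodule.smul_mem _ _ ?_
      clear hm hxS
      induction hx using Submodule.span_induction with
      | mem x hx =>
        obtain ⟨p, -, rfl⟩ := hx
        refine Submodule.subset_span ⟨(p.1, m + p.2), by simp, ?_⟩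
        simp [monomialMultiple, smul_smul, MvPolynomial.monomial_mul]
      | zero => simp
      | add x y _ _ hx hy => rw [smul_add]; exact add_mem hx hy
      | smul d x _ hx => rw [smul_comm]; exact Submodule.smul_mem _ _ hx

/-- The order used for the greedy bases: compare generators, then monomials. Multiplication by a
variable preserves it. -/
def orderKey {r : ℕ} (p : Fin r × (Fin (n + 1) →₀ ℕ)) : Fin r ×ₗ Lex (Fin (n + 1) →₀ ℕ) :=
  toLex (p.1, toLex p.2)

theorem orderKey_injective {r : ℕ} : Function.Injective (orderKey (n := n) (r := r)) := by
  intro p q h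
  simpa [orderKey, Prod.ext_iff] using h

theorem orderKey_add_lt {r : ℕ} {p q : Fin r × (Fin (n + 1) →₀ ℕ)} (h : orderKey p < orderKey q)
    (m : Fin (n + 1) →₀ ℕ) : orderKey (p.1, p.2 + m) < orderKey (q.1, q.2 + m) := by
  simp only [orderKey, Prod.Lex.toLex_lt_toLex, toLex_add] at h ⊢
  exact h.imp id fun h => ⟨h.1, add_lt_add_left h.2 _⟩

/-- The growth bound for modules generated in degree zero: `dim M_j / dim S_j` does not increase. A
greedy basis of `M_(j+1)` consists of monomial multiples of generators whose quotients by variables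
lie in the greedy basis of `M_j`, so that monomials can be counted. -/
theorem succ_mul_hilbertFunction_le (hfin : Module.Finite (S k n) M) (hℳ : IsGrading n ℳ)
    (hgen : GeneratedInDegreeZero n ℳ) (j : ℕ) :
    (j + 1) * hilbertFunction ℳ (j + 1) ≤ (j + (n + 1)) * hilbertFunction ℳ j := by
  classical
  obtain ⟨r, g, hg, hspan⟩ := exists_generators_mem_zero hfin hgen
  let s : ℕ → Finset (Fin r × (Fin (n + 1) →₀ ℕ)) := fun j => univ ×ˢ univ.finsuppAntidiag j
  have hs : ∀ j p, p ∈ s j ↔ p.2.degree = j := fun j p => by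
    simp [s, Finsupp.degree_eq_sum]
  have hdim : ∀ j, hilbertFunction ℳ j = #(greedyBasis k orderKey (monomialMultiple k g) (s j)) :=
    fun j => by
      rw [← finrank_span_eq_card_greedyBasis orderKey_injective, hilbertFunction,
        ← span_monomialMultiple hℳ hg hspan j]
      rw [show {p | p.2.degree = j} = (s j : Set (Fin r × (Fin (n + 1) →₀ ℕ))) from
        Set.ext fun p => (hs j p).symm]
  rw [hdim, hdim]
  refine succ_mul_card_le (Fintype.card_fin _) (fun b hb => (hs j b).1 (mem_greedyBasis.1 hb).1)
    (fun b hb => (hs _ b).1 (mem_greedyBasis.1 hb).1) fun i m l hm => ?_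
  -- Multiplying a relation in degree `j` by `x_l` yields a relation in degree `j + 1`.
  rw [mem_greedyBasis, hs] at hm ⊢
  obtain ⟨hdeg, hm⟩ := hm
  refine ⟨by simpa using hdeg, fun h => hm ?_⟩
  let f : M →ₗ[k] M :=
    Algebra.lsmul k k M (MvPolynomial.monomial (Finsupp.single l 1) (1 : k) : S k n)
  have hf : ∀ p : Fin r × (Fin (n + 1) →₀ ℕ), f (monomialMultiple k g p) =
      monomialMultiple k g (p.1, p.2 + Finsupp.single l 1) := fun p => by
    simp [f, monomialMultiple, smul_smul, MvPolynomial.monomial_mul, add_comm]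
  have h' := Submodule.mem_map_of_mem (f := f) h
  rw [hf, Submodule.map_span, ← Set.image_comp] at h'
  refine Submodule.span_mono ?_ h'
  rintro _ ⟨p, ⟨hp, hlt⟩, rfl⟩
  refine ⟨(p.1, p.2 + Finsupp.single l 1), ⟨?_, orderKey_add_lt hlt _⟩, (hf p).symm⟩
  rw [hs] at hp ⊢
  simp [hp]

end Growth

/-- `T` maps Hilbert functions to sequences of natural numbers. -/
theorem exists_T_eq_natCast {k : Type u} [Field k] {n : ℕ} {h : ℕ → ℕ}
    (hh : h ∈ hilbertFunctions k n) :
    ∃ g : ℕ → ℕ, T n (fun j => (h j : ℚ)) = fun j => (g j : ℚ) := by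
  obtain ⟨M, _, _, _, _, ℳ, hfin, hℳ, hgen, -, rfl⟩ := hh
  refine ⟨fun j => (j + (n + 1)) * hilbertFunction ℳ j - (j + 1) * hilbertFunction ℳ (j + 1), ?_⟩
  funext j
  rw [Nat.cast_sub (succ_mul_hilbertFunction_le hfin hℳ hgen j)]
  simp only [T, LinearMap.coe_mk, AddHom.coe_mk]
  push_cast
  ring

end GrowthBound

/-! ### Torsion modules and quotients by monomial ideals -/

section Modules

open Finset

section Torsion

variable {k : Type u} [Field k] {n : ℕ}

theorem noFreeSummand_of_torsion {R M : Type u} [CommRing R] [IsDomain R] [AddCommGroup M]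
    [Module R M] (h : ∀ x : M, ∃ r : R, r ≠ 0 ∧ r • x = 0) : NoFreeSummand R M := by
  intro F N _ _
  refine (Submodule.eq_bot_iff F).2 fun x hx => ?_
  obtain ⟨r, hr, hrx⟩ := h x
  have : r • (⟨x, hx⟩ : F) = 0 := Subtype.ext hrx
  exact congrArg Subtype.val ((smul_eq_zero.1 this).resolve_left hr)

/-- The graded pieces are finite-dimensional, so that `finrank` is not a junk value on them. -/
theorem finite_component {M : Type u} [AddCommGroup M] [Module k M]
    [Module (S k n) M] [IsScalarTower k (S k n) M] {ℳ : ℕ → Submodule k M}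
    (hfin : Module.Finite (S k n) M) (hℳ : IsGrading n ℳ)
    (hgen : GeneratedInDegreeZero n ℳ) (j : ℕ) : Module.Finite k (ℳ j) := by
  classical
  obtain ⟨r, g, hg, hspan⟩ := exists_generators_mem_zero hfin hgen
  rw [← span_monomialMultiple hℳ hg hspan j]
  refine Module.Finite.span_of_finite k (Set.Finite.image _ ?_)
  refine (univ ×ˢ univ.finsuppAntidiag j : Finset (Fin r × (Fin (n + 1) →₀ ℕ))).finite_toSet.subset
    fun p hp => ?_
  simpa [Finsupp.degree_eq_sum] using hp

/-- The Hilbert functions of the finitely generated graded torsion modules that are generated in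
degree zero. In contrast to the absence of free summands, torsion visibly passes to direct sums. -/
def torsionHilbertFunctions (k : Type u) [Field k] (n : ℕ) : Set (ℕ → ℕ) :=
  {h | ∃ (M : Type u) (_ : AddCommGroup M) (_ : Module k M) (_ : Module (S k n) M)
      (_ : IsScalarTower k (S k n) M) (ℳ : ℕ → Submodule k M),
      Module.Finite (S k n) M ∧ IsGrading n ℳ ∧ GeneratedInDegreeZero n ℳ ∧
      (∀ x : M, ∃ p : S k n, p ≠ 0 ∧ p • x = 0) ∧ h = hilbertFunction ℳ}

theorem torsionHilbertFunctions_subset : torsionHilbertFunctions k n ⊆ hilbertFunctions k n := by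
  rintro h ⟨M, i1, i2, i3, i4, ℳ, h1, h2, h3, h4, h5⟩
  exact ⟨M, i1, i2, i3, i4, ℳ, h1, h2, h3, noFreeSummand_of_torsion h4, h5⟩

theorem iSup_prod_eq_top {R W W' ι : Type*} [Ring R] [AddCommGroup W] [Module R W]
    [AddCommGroup W'] [Module R W'] {p : ι → Submodule R W} {q : ι → Submodule R W'}
    (hp : ⨆ i, p i = ⊤) (hq : ⨆ i, q i = ⊤) : ⨆ i, (p i).prod (q i) = ⊤ := by
  refine eq_top_iff.2 fun x _ => ?_
  have h1 : (x.1, 0) ∈ ⨆ i, (p i).prod (q i) := by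
    have : LinearMap.inl R W W' x.1 ∈ (⨆ i, p i).map (LinearMap.inl R W W') :=
      Submodule.mem_map_of_mem (hp ▸ trivial)
    rw [Submodule.map_iSup] at this
    have hle : ⨆ i, (p i).map (LinearMap.inl R W W') ≤ ⨆ i, (p i).prod (q i) :=
      iSup_mono fun i => by
        rintro _ ⟨y, hy, rfl⟩
        exact ⟨hy, zero_mem _⟩
    exact hle this
  have h2 : (0, x.2) ∈ ⨆ i, (p i).prod (q i) := by
    have : LinearMap.inr R W W' x.2 ∈ (⨆ i, q i).map (LinearMap.inr R W W') :=
      Submodule.mem_map_of_mem (hq ▸ trivial)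
    rw [Submodule.map_iSup] at this
    have hle : ⨆ i, (q i).map (LinearMap.inr R W W') ≤ ⨆ i, (p i).prod (q i) :=
      iSup_mono fun i => by
        rintro _ ⟨y, hy, rfl⟩
        exact ⟨zero_mem _, hy⟩
    exact hle this
  simpa using add_mem h1 h2

theorem isInternal_prod {W W' : Type*} [AddCommGroup W] [Module k W] [AddCommGroup W'] [Module k W']
    {p : ℕ → Submodule k W} {q : ℕ → Submodule k W'} (hp : DirectSum.IsInternal p)
    (hq : DirectSum.IsInternal q) : DirectSum.IsInternal fun i => (p i).prod (q i) := by
  refine DirectSum.isInternal_submodule_of_iSupIndep_of_iSup_eq_top (fun i => ?_)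
    (iSup_prod_eq_top hp.submodule_iSup_eq_top hq.submodule_iSup_eq_top)
  rw [Submodule.disjoint_def]
  intro x hx hx'
  have hle : ⨆ j ≠ i, (p j).prod (q j) ≤ (⨆ j ≠ i, p j).prod (⨆ j ≠ i, q j) :=
    iSup₂_le fun j hj => Submodule.prod_mono (le_iSup₂ (f := fun j (_ : j ≠ i) => p j) j hj)
      (le_iSup₂ (f := fun j (_ : j ≠ i) => q j) j hj)
  have hx' := hle hx'
  exact Prod.ext (Submodule.disjoint_def.1 (hp.submodule_iSupIndep i) _ hx.1 hx'.1)
    (Submodule.disjoint_def.1 (hq.submodule_iSupIndep i) _ hx.2 hx'.2)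

theorem add_mem_torsionHilbertFunctions {h h' : ℕ → ℕ} (hh : h ∈ torsionHilbertFunctions k n)
    (hh' : h' ∈ torsionHilbertFunctions k n) : h + h' ∈ torsionHilbertFunctions k n := by
  obtain ⟨M, _, _, _, _, ℳ, hfin, hℳ, hgen, htor, rfl⟩ := hh
  obtain ⟨M', _, _, _, _, ℳ', hfin', hℳ', hgen', htor', rfl⟩ := hh'
  refine ⟨M × M', inferInstance, inferInstance, inferInstance, inferInstance,
    fun j => (ℳ j).prod (ℳ' j), inferInstance, ⟨isInternal_prod hℳ.isInternal hℳ'.isInternal,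
      fun i j p m hp hm => ⟨hℳ.smul_mem i j p _ hp hm.1, hℳ'.smul_mem i j p _ hp hm.2⟩⟩, ?_, ?_, ?_⟩
  · refine eq_top_iff.2 fun x _ => ?_
    have h1 : LinearMap.inl (S k n) M M' x.1 ∈
        (Submodule.span (S k n) (ℳ 0 : Set M)).map (LinearMap.inl (S k n) M M') :=
      Submodule.mem_map_of_mem ((show _ = ⊤ from hgen) ▸ trivial)
    have h2 : LinearMap.inr (S k n) M M' x.2 ∈
        (Submodule.span (S k n) (ℳ' 0 : Set M')).map (LinearMap.inr (S k n) M M') :=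
      Submodule.mem_map_of_mem ((show _ = ⊤ from hgen') ▸ trivial)
    rw [Submodule.map_span] at h1 h2
    have h3 := add_mem (Submodule.span_mono (t := ((ℳ 0).prod (ℳ' 0) : Set (M × M'))) (by
      rintro _ ⟨y, hy, rfl⟩
      exact ⟨hy, zero_mem _⟩) h1) (Submodule.span_mono (by
      rintro _ ⟨y, hy, rfl⟩
      exact ⟨zero_mem _, hy⟩) h2)
    simpa using h3
  · rintro ⟨x, y⟩
    obtain ⟨p, hp, hpx⟩ := htor x
    obtain ⟨q, hq, hqy⟩ := htor' y
    refine ⟨p * q, mul_ne_zero hp hq, Prod.ext ?_ ?_⟩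
    · simp [mul_comm p q, mul_smul, hpx]
    · simp [mul_smul, hqy]
  · funext j
    have := finite_component hfin hℳ hgen j
    have := finite_component hfin' hℳ' hgen' j
    let e : (ℳ j × ℳ' j) →ₗ[k] M × M' := (ℳ j).subtype.prodMap (ℳ' j).subtype
    have he : Function.Injective e :=
      Prod.map_injective.2 ⟨Subtype.val_injective, Subtype.val_injective⟩
    have hrange : LinearMap.range e = (ℳ j).prod (ℳ' j) := by
      simp [e, LinearMap.range_prodMap]
    change Module.finrank k (ℳ j) + Module.finrank k (ℳ' j) =
      Module.finrank k ((ℳ j).prod (ℳ' j) : Submodule k (M × M'))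
    rw [← Module.finrank_prod, ← hrange, LinearMap.finrank_range_of_inj he]

end Torsion

section MonomialQuotient

variable (k : Type u) [Field k] {n : ℕ} {U : Set (Fin (n + 1) →₀ ℕ)} (hU : IsUpperSet U)

/-- The grading of the quotient of `S` by the ideal spanned by the monomials in `U`. -/
noncomputable def quotientGrading (j : ℕ) :
    Submodule k (S k n ⧸ MvPolynomial.restrictSupportIdeal (R := k) U hU) :=
  (MvPolynomial.homogeneousSubmodule (Fin (n + 1)) k j).map
    ((Submodule.mkQ (MvPolynomial.restrictSupportIdeal (R := k) U hU)).restrictScalars k)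

theorem mem_restrictSupportIdeal {p : S k n} :
    p ∈ MvPolynomial.restrictSupportIdeal (R := k) U hU ↔ ∀ m, p.coeff m ≠ 0 → m ∈ U := by
  change p ∈ MvPolynomial.restrictSupport k U ↔ _
  simp [MvPolynomial.mem_restrictSupport_iff, Set.subset_def]

theorem isGrading_quotientGrading : IsGrading n (quotientGrading k hU) := by
  refine ⟨DirectSum.isInternal_submodule_of_iSupIndep_of_iSup_eq_top (fun i => ?_) ?_, ?_⟩
  · rw [Submodule.disjoint_def]
    intro x hx hx'
    have : ⨆ j ≠ i, quotientGrading k hU j =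
        (⨆ j ≠ i, MvPolynomial.homogeneousSubmodule (Fin (n + 1)) k j).map
        ((Submodule.mkQ (MvPolynomial.restrictSupportIdeal (R := k) U hU)).restrictScalars k) := by
      simp only [Submodule.map_iSup, quotientGrading]
    rw [this] at hx'
    obtain ⟨p, hp, rfl⟩ := hx
    obtain ⟨r, hr, hrp⟩ := hx'
    have hr0 : MvPolynomial.homogeneousComponent i r = 0 := by
      have hle : ⨆ j ≠ i, MvPolynomial.homogeneousSubmodule (Fin (n + 1)) k j ≤
          LinearMap.ker (MvPolynomial.homogeneousComponent (R := k) (σ := Fin (n + 1)) i) :=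
        iSup₂_le fun j hj q hq => by
          rw [LinearMap.mem_ker, MvPolynomial.homogeneousComponent_of_mem hq, if_neg hj.symm]
      exact hle hr
    have hpr : r - p ∈ MvPolynomial.restrictSupportIdeal (R := k) U hU :=
      (Submodule.Quotient.eq _).1 hrp
    -- Monomial ideals contain the homogeneous components of their members.
    refine (Submodule.Quotient.mk_eq_zero _).2 ((mem_restrictSupportIdeal k hU).2 fun m hm => ?_)
    refine (mem_restrictSupportIdeal k hU).1 hpr m ?_
    have h1 := congrArg (MvPolynomial.coeff m) hr0
    have h2 := congrArg (MvPolynomial.coeff m) (MvPolynomial.homogeneousComponent_eq_self hp)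
    rw [MvPolynomial.coeff_homogeneousComponent] at h1 h2
    split_ifs at h1 h2 with hdeg
    · rw [MvPolynomial.coeff_sub, h1, MvPolynomial.coeff_zero, zero_sub]
      exact neg_ne_zero.2 hm
    · exact absurd h2.symm hm
  · have : ⨆ j, MvPolynomial.homogeneousSubmodule (Fin (n + 1)) k j = ⊤ :=
      eq_top_iff.2 fun p _ => by
        rw [← MvPolynomial.sum_homogeneousComponent p]
        exact sum_mem fun i _ => Submodule.mem_iSup_of_mem i
          (MvPolynomial.homogeneousComponent_mem i p)
    unfold quotientGrading
    rw [← Submodule.map_iSup, this, Submodule.map_top, LinearMap.range_eq_top]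
    exact Submodule.mkQ_surjective _
  · rintro i j p _ hp ⟨q, hq, rfl⟩
    exact ⟨p * q, MvPolynomial.IsHomogeneous.mul hp hq, rfl⟩

theorem generatedInDegreeZero_quotientGrading :
    GeneratedInDegreeZero n (quotientGrading k hU) := by
  refine eq_top_iff.2 fun x _ => ?_
  obtain ⟨p, rfl⟩ := Submodule.mkQ_surjective _ x
  have h1 : Submodule.mkQ (MvPolynomial.restrictSupportIdeal (R := k) U hU) 1 ∈
      quotientGrading k hU 0 := ⟨1, MvPolynomial.isHomogeneous_one _ _, rfl⟩
  have := Submodule.smul_mem _ p (Submodule.subset_span (R := S k n) h1)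
  rwa [← map_smul, smul_eq_mul, mul_one] at this

/-- The monomials outside `U` form bases of the graded pieces of the quotient. -/
theorem hilbertFunction_quotientGrading {j : ℕ} {A : Finset (Fin (n + 1) →₀ ℕ)}
    (hA : ∀ m, m ∈ A ↔ m.degree = j ∧ m ∉ U) :
    hilbertFunction (quotientGrading k hU) j = #A := by
  set q := (Submodule.mkQ (MvPolynomial.restrictSupportIdeal (R := k) U hU)).restrictScalars k
    with hq
  have hmap : quotientGrading k hU j = (MvPolynomial.restrictSupport k (A : Set _)).map q := by
    have hH : MvPolynomial.homogeneousSubmodule (Fin (n + 1)) k j =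
        MvPolynomial.restrictSupport k {m | m.degree = j} :=
      MvPolynomial.homogeneousSubmodule_eq_finsupp_supported _ _ _
    rw [quotientGrading, hH, ← hq]
    refine le_antisymm ?_ (Submodule.map_mono
      (MvPolynomial.restrictSupport_mono _ fun m hm => ((hA m).1 hm).1))
    rw [MvPolynomial.restrictSupport_eq_span, Submodule.map_span, Submodule.span_le]
    rintro _ ⟨_, ⟨m, hm, rfl⟩, rfl⟩
    by_cases hmU : m ∈ U
    · have : q (MvPolynomial.monomial m 1) = 0 := by
        refine (Submodule.Quotient.mk_eq_zero _).2 ?_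
        change _ ∈ MvPolynomial.restrictSupport k U
        simp [hmU]
      rw [this]
      exact zero_mem _
    · refine Submodule.mem_map_of_mem ?_
      rw [MvPolynomial.monomial_mem_restrictSupport]
      exact Or.inl ((hA m).2 ⟨hm, hmU⟩)
  have hinj : Function.Injective (q.domRestrict (MvPolynomial.restrictSupport k (A : Set _))) := by
    refine LinearMap.ker_eq_bot.1 (LinearMap.ker_eq_bot'.2 fun p hp => Subtype.ext ?_)
    have hpU := (mem_restrictSupportIdeal k hU).1 ((Submodule.Quotient.mk_eq_zero _).1 hp)
    ext m
    by_contra hm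
    exact ((hA m).1 (p.2 (MvPolynomial.mem_support_iff.2 hm))).2 (hpU m hm)
  rw [hilbertFunction, hmap, ← LinearMap.range_domRestrict, LinearMap.finrank_range_of_inj hinj]
  exact (Module.finrank_eq_card_basis
    (MvPolynomial.basisRestrictSupport k (A : Set (Fin (n + 1) →₀ ℕ)))).trans (by simp)

/-- The number of standard monomials of a nonzero monomial ideal, as a function of the degree, is a
Hilbert function. -/
theorem mem_torsionHilbertFunctions (hU : IsUpperSet U) (hne : U.Nonempty)
    {A : ℕ → Finset (Fin (n + 1) →₀ ℕ)}
    (hA : ∀ j m, m ∈ A j ↔ m.degree = j ∧ m ∉ U) :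
    (fun j => #(A j)) ∈ torsionHilbertFunctions k n := by
  refine ⟨_, inferInstance, inferInstance, inferInstance, inferInstance, quotientGrading k hU,
    inferInstance, isGrading_quotientGrading k hU, generatedInDegreeZero_quotientGrading k hU,
    fun x => ?_, funext fun j => (hilbertFunction_quotientGrading k hU (hA j)).symm⟩
  obtain ⟨m, hm⟩ := hne
  obtain ⟨p, rfl⟩ := Submodule.mkQ_surjective _ x
  refine ⟨MvPolynomial.monomial m 1, by simp, ?_⟩
  rw [← map_smul]
  refine (Submodule.Quotient.mk_eq_zero _).2 (Ideal.mul_mem_right _ _ ?_)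
  change _ ∈ MvPolynomial.restrictSupport k U
  simp [hm]

end MonomialQuotient

end Modules

/-! ### Generating functions of quotients by powers of ideals of variables -/

section PowerQuotients

open Finset hiding mk
open PowerSeries

/-- The number of monomials of degree `j` that have degree `e` in the variables in `s`: they are the
products of a monomial of degree `e` in these variables and one of degree `j - e` in the others. -/
theorem card_filter_sum_eq {σ : Type*} [Fintype σ] [DecidableEq σ] (s : Finset σ)
    {e j : ℕ} (hej : e ≤ j) :
    #{m ∈ univ.finsuppAntidiag j | ∑ i ∈ s, m i = e} =
      #(s.finsuppAntidiag e) * #(sᶜ.finsuppAntidiag (j - e)) := by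
  rw [← card_product]
  refine card_nbij' (fun m => (m.filter (· ∈ s), m.filter (· ∉ s))) (fun p => p.1 + p.2) ?_ ?_ ?_ ?_
  · intro m hm
    simp only [coe_filter, Set.mem_ofPred_eq, mem_finsuppAntidiag] at hm
    simp only [coe_product, Set.mem_prod, mem_coe, mem_finsuppAntidiag]
    have h1 : ∑ i ∈ s, m i + ∑ i ∈ sᶜ, m i = ∑ i, m i := sum_add_sum_compl s m
    refine ⟨⟨?_, fun i hi => ?_⟩, ?_, fun i hi => ?_⟩
    · rw [← hm.2]
      exact sum_congr rfl fun i hi => by simp [hi]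
    · simp_all
    · have h2 : ∑ i ∈ sᶜ, m.filter (· ∉ s) i = ∑ i ∈ sᶜ, m i :=
        sum_congr rfl fun i hi => by simp [mem_compl.1 hi]
      rw [h2]
      lia
    · simp_all
  · intro p hp
    simp only [coe_product, Set.mem_prod, mem_coe, mem_finsuppAntidiag] at hp
    simp only [coe_filter, Set.mem_ofPred_eq, mem_finsuppAntidiag]
    have h1 : ∀ i ∈ s, p.2 i = 0 := fun i hi =>
      Finsupp.notMem_support_iff.1 fun h => mem_compl.1 (hp.2.2 h) hi
    have h2 : ∀ i ∈ sᶜ, p.1 i = 0 := fun i hi =>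
      Finsupp.notMem_support_iff.1 fun h => mem_compl.1 hi (hp.1.2 h)
    have h3 : ∑ i ∈ s, (p.1 + p.2) i = e := by
      rw [← hp.1.1]
      exact sum_congr rfl fun i hi => by simp [h1 i hi]
    have h4 : ∑ i ∈ sᶜ, (p.1 + p.2) i = j - e := by
      rw [← hp.2.1]
      exact sum_congr rfl fun i hi => by simp [h2 i hi]
    refine ⟨⟨?_, subset_univ _⟩, h3⟩
    rw [← sum_add_sum_compl s, h3, h4]
    lia
  · intro m _
    exact Finsupp.filter_add_filter_not _ _
  · intro p hp
    simp only [coe_product, Set.mem_prod, mem_coe, mem_finsuppAntidiag] at hp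
    have h1 : ∀ i ∈ s, p.2 i = 0 := fun i hi =>
      Finsupp.notMem_support_iff.1 fun h => mem_compl.1 (hp.2.2 h) hi
    have h2 : ∀ i ∉ s, p.1 i = 0 := fun i hi =>
      Finsupp.notMem_support_iff.1 fun h => hi (hp.1.2 h)
    refine Prod.ext (Finsupp.ext fun i => ?_) (Finsupp.ext fun i => ?_)
    · by_cases hi : i ∈ s
      · simp [hi, h1 i hi]
      · simp [hi, h2 i hi]
    · by_cases hi : i ∈ s
      · simp [hi, h1 i hi]
      · simp [hi, h2 i hi]

theorem coeff_mk_one_pow_eq_card {σ : Type*} [DecidableEq σ] (s : Finset σ) (j : ℕ) :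
    coeff j ((mk 1 : ℚ⟦X⟧) ^ #s) = #(s.finsuppAntidiag j) := by
  rw [← prod_const, coeff_prod]
  simp

/-- The generating function `(1 + c t + ⋯ + choose(c + d - 1, d) t^d) / (1 - t)^m` of the quotient
of a polynomial ring in `c + m` variables by the power `d + 1` of the ideal of `c` variables; here
`c = c' + 1`. -/
noncomputable def powerQuotientSeries (c' m d : ℕ) : ℚ⟦X⟧ :=
  (∑ e ∈ range (d + 1), C ((c' + e).choose e : ℚ) * X ^ e) * mk 1 ^ m

theorem mk_card_eq_powerQuotientSeries {σ : Type*} [Fintype σ] [DecidableEq σ] (s : Finset σ)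
    {c' m : ℕ} (hc : #s = c' + 1) (hm : #sᶜ = m) (d : ℕ) :
    mk (fun j => (#{x ∈ (univ : Finset σ).finsuppAntidiag j | ∑ i ∈ s, x i ≤ d} : ℚ)) =
      powerQuotientSeries c' m d := by
  ext j
  have hcard : #{x ∈ (univ : Finset σ).finsuppAntidiag j | ∑ i ∈ s, x i ≤ d} =
      ∑ e ∈ range (d + 1), #{x ∈ (univ : Finset σ).finsuppAntidiag j | ∑ i ∈ s, x i = e} := by
    rw [card_eq_sum_card_fiberwise (f := fun x : σ →₀ ℕ => ∑ i ∈ s, x i) (t := range (d + 1))]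
    · refine sum_congr rfl fun e he => ?_
      rw [filter_filter]
      congr! 2 with x
      rw [mem_range] at he
      lia
    · intro x hx
      simp only [coe_filter, Set.mem_ofPred_eq] at hx
      simp only [coe_range, Set.mem_Iio]
      lia
  rw [coeff_mk, hcard, powerQuotientSeries, sum_mul, map_sum, Nat.cast_sum]
  refine sum_congr rfl fun e _ => ?_
  rw [mul_assoc, coeff_C_mul, coeff_X_pow_mul']
  split_ifs with hej
  · rw [card_filter_sum_eq s hej, ← hm, coeff_mk_one_pow_eq_card, Nat.cast_mul,
      card_finsuppAntidiag_nat_eq_choose, hc]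
    congr 3
    lia
  · rw [mul_zero, Nat.cast_eq_zero, card_eq_zero, filter_eq_empty_iff]
    intro x hx hxe
    rw [mem_finsuppAntidiag] at hx
    have := sum_le_sum_of_subset (f := x) (subset_univ s)
    lia

theorem powerQuotientSeries_mul_pow_mem {c' m n : ℕ} (hm : m ≤ n) (d : ℕ) :
    powerQuotientSeries c' m d * (1 - X) ^ n ∈ polynomialSubring := by
  have one : (mk 1 : ℚ⟦X⟧) ^ m * (1 - X) ^ m = 1 := by
    rw [← mul_pow, mk_one_mul_one_sub_eq_one ℚ, one_pow]
  have : powerQuotientSeries c' m d * (1 - X) ^ n =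
      (∑ e ∈ range (d + 1), C ((c' + e).choose e : ℚ) * X ^ e) * (1 - X) ^ (n - m) := by
    rw [powerQuotientSeries, ← Nat.add_sub_of_le hm, pow_add, Nat.add_sub_cancel_left]
    linear_combination ((∑ e ∈ range (d + 1), C ((c' + e).choose e : ℚ) * X ^ e) *
      (1 - X) ^ (n - m)) * one
  rw [this]
  refine mul_mem (sum_mem fun e _ => mul_mem ?_ (pow_mem X_mem_polynomialSubring _))
    (pow_mem (sub_mem (one_mem _) X_mem_polynomialSubring) _)
  exact mem_polynomialSubring.2 ⟨_, (Polynomial.coe_C _).symm⟩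

/-- The partial sums of `(1 - t)^{-c}`, `c = c' + 1`, satisfy the differential equation of
`(1 - t)^{-c}` up to their last term. -/
theorem mul_partialSum_sub_one_sub_X_mul_derivative (c' d : ℕ) :
    C ((c' : ℚ) + 1) * (∑ e ∈ range (d + 1), C ((c' + e).choose e : ℚ) * X ^ e) -
      (1 - X) * d⁄dX ℚ (∑ e ∈ range (d + 1), C ((c' + e).choose e : ℚ) * X ^ e) =
      C (((d : ℚ) + 1) * (c' + (d + 1)).choose (d + 1)) * X ^ d := by
  have hder : ∀ e : ℕ, d⁄dX ℚ (C ((c' + (e + 1)).choose (e + 1) : ℚ) * X ^ (e + 1)) =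
      C (((e : ℚ) + 1) * (c' + (e + 1)).choose (e + 1)) * X ^ e := fun e => by
    rw [Derivation.leibniz, derivative_C, derivative_pow, derivative_X]
    simp
    ring
  have hbinom : ∀ e : ℕ, ((e : ℚ) + 1) * (c' + (e + 1)).choose (e + 1) =
      (c' + e + 1) * (c' + e).choose e := fun e => by
    have := Nat.add_one_mul_choose_eq (c' + e) e
    rw [mul_comm]
    exact_mod_cast this.symm
  induction d with
  | zero => simp
  | succ d ih =>
    rw [sum_range_succ, map_add (d⁄dX ℚ), hder, hbinom (d + 1)]
    have h1 : C ((c' : ℚ) + (d + 1 : ℕ) + 1) = C ((c' : ℚ) + 1) + C ((d : ℚ) + 1) := by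
      rw [← map_add]
      congr 1
      push_cast
      ring
    rw [map_mul, map_mul, h1]
    rw [map_mul] at ih
    linear_combination ih

/-- The image under `T` keeps only the last term of the numerator. -/
theorem mk_T_of_mk_eq_powerQuotientSeries {c' m n d : ℕ} (hcm : c' + m = n) {h : ℕ → ℚ}
    (hh : mk h = powerQuotientSeries c' m d) :
    mk (T n h) = ((d + 1) * (c' + (d + 1)).choose (d + 1)) • (X ^ d * mk 1 ^ m) := by
  have one : (mk 1 : ℚ⟦X⟧) * (1 - X) = 1 := mk_one_mul_one_sub_eq_one ℚ
  have d1 : d⁄dX ℚ (mk 1 : ℚ⟦X⟧) = mk 1 ^ 2 := by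
    ext j
    rw [coeff_derivative, coeff_mk, mk_one_pow_eq_mk_choose_add ℚ 1, coeff_mk]
    simp [add_comm]
  rw [mk_T, hh, powerQuotientSeries, Derivation.leibniz, derivative_pow, d1]
  have key := mul_partialSum_sub_one_sub_X_mul_derivative c' d
  set B : ℚ⟦X⟧ := ∑ e ∈ range (d + 1), C ((c' + e).choose e : ℚ) * X ^ e
  have hpow : (m : ℚ⟦X⟧) * (mk 1 : ℚ⟦X⟧) ^ (m - 1) * (mk 1 : ℚ⟦X⟧) ^ 2 * (1 - X) =
      (m : ℚ⟦X⟧) * (mk 1 : ℚ⟦X⟧) ^ m := by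
    rcases m with _ | m
    · simp
    · rw [Nat.add_sub_cancel]
      linear_combination ((m + 1 : ℕ) : ℚ⟦X⟧) * mk 1 ^ (m + 1) * one
  have hn : (n : ℚ⟦X⟧) = c' + m := by rw [← hcm]; push_cast; rfl
  simp only [map_add, map_mul, map_natCast, map_one] at key
  simp only [smul_eq_mul, nsmul_eq_mul]
  push_cast
  rw [hn]
  linear_combination mk 1 ^ m * key - B * hpow

end PowerQuotients

/-! ### Realization by Hilbert functions -/

section Realization

open Finset hiding mk
open PowerSeries

variable (k : Type u) [Field k]

/-- Each of the series `t^i / (1 - t)^m`, `m ≤ n`, is up to a positive factor the image under `T` of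
the Hilbert function of the quotient of `S` by the `(i + 1)`-st power of an ideal generated by
`n + 1 - m` variables. -/
theorem exists_T_eq_smul_X_pow_mul {n : ℕ} (i : ℕ) {m : ℕ} (hm : m ≤ n) :
    ∃ h ∈ torsionHilbertFunctions k n, ∃ N : ℕ, 0 < N ∧
      mk (fun j => (h j : ℚ)) * (1 - X) ^ n ∈ polynomialSubring ∧
      mk (T n (fun j => (h j : ℚ))) = N • (X ^ i * mk 1 ^ m) := by
  obtain ⟨s, -, hs⟩ := exists_subset_card_eq (s := (univ : Finset (Fin (n + 1)))) (n := n - m + 1)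
    (by rw [card_univ, Fintype.card_fin]; lia)
  have hsc : #sᶜ = m := by
    rw [card_compl, hs, Fintype.card_fin]
    lia
  let U : Set (Fin (n + 1) →₀ ℕ) := {x | i < ∑ l ∈ s, x l}
  have hU : IsUpperSet U := fun x y hxy hx => lt_of_lt_of_le hx (sum_le_sum fun l _ => hxy l)
  have hne : U.Nonempty := by
    obtain ⟨l, hl⟩ := card_pos.1 (show 0 < #s by lia)
    refine ⟨Finsupp.single l (i + 1), ?_⟩
    have := single_le_sum (f := Finsupp.single l (i + 1)) (fun _ _ => Nat.zero_le _) hl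
    rw [Finsupp.single_eq_same] at this
    exact this
  have hH := mk_card_eq_powerQuotientSeries s hs hsc i
  refine ⟨fun j => #{x ∈ (univ : Finset (Fin (n + 1))).finsuppAntidiag j | ∑ l ∈ s, x l ≤ i},
    mem_torsionHilbertFunctions k hU hne fun j x => ?_,
    (i + 1) * (n - m + (i + 1)).choose (i + 1), ?_, ?_, ?_⟩
  · simp [U, Finsupp.degree_eq_sum]
  · exact mul_pos (Nat.succ_pos _) (Nat.choose_pos (by lia))
  · rw [hH]
    exact powerQuotientSeries_mul_pow_mem hm i
  · exact mk_T_of_mk_eq_powerQuotientSeries (by lia) hH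

theorem zero_mem_torsionHilbertFunctions (n : ℕ) : 0 ∈ torsionHilbertFunctions k n :=
  mem_torsionHilbertFunctions k (U := Set.univ) isUpperSet_univ Set.univ_nonempty
    (A := fun _ => (∅ : Finset (Fin (n + 1) →₀ ℕ))) fun j m => by simp

theorem nsmul_mem_torsionHilbertFunctions {n : ℕ} {h : ℕ → ℕ} (hh : h ∈ torsionHilbertFunctions k n)
    (N : ℕ) : N • h ∈ torsionHilbertFunctions k n := by
  induction N with
  | zero => simpa using zero_mem_torsionHilbertFunctions k n
  | succ N ih => rw [succ_nsmul]; exact add_mem_torsionHilbertFunctions ih hh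

/-- All sums of the series `t^i / (1 - t)^m`, `m ≤ n`, are up to a positive factor images under `T`
of Hilbert functions. -/
theorem exists_T_eq_smul_of_mem_binomialCone {n : ℕ} {G : ℚ⟦X⟧} (hG : G ∈ binomialCone n) :
    ∃ h ∈ torsionHilbertFunctions k n, ∃ N : ℕ, 0 < N ∧
      mk (fun j => (h j : ℚ)) * (1 - X) ^ n ∈ polynomialSubring ∧
      mk (T n (fun j => (h j : ℚ))) = N • G := by
  induction hG using AddSubmonoid.closure_induction with
  | mem G hG =>
    obtain ⟨i, m, hm, rfl⟩ := hG
    exact exists_T_eq_smul_X_pow_mul k i hm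
  | zero =>
    refine ⟨0, zero_mem_torsionHilbertFunctions k n, 1, one_pos, ?_, ?_⟩
    · have : mk (fun j => (((0 : ℕ → ℕ) j : ℕ) : ℚ)) = 0 := by ext; simp
      rw [this, zero_mul]
      exact zero_mem _
    · have : (fun j => (((0 : ℕ → ℕ) j : ℕ) : ℚ)) = 0 := by ext; simp
      rw [this, map_zero, smul_zero]
      ext; simp
  | add G G' _ _ hG hG' =>
    obtain ⟨h, hh, N, hN, hp, hT⟩ := hG
    obtain ⟨h', hh', N', hN', hp', hT'⟩ := hG'
    have cast_eq : (fun j => (((N' • h + N • h') j : ℕ) : ℚ)) =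
        N' • (fun j => (h j : ℚ)) + N • fun j => (h' j : ℚ) := by
      funext j; simp
    have mk_add : ∀ f g : ℕ → ℚ, mk (N' • f + N • g) = N' • mk f + N • mk g := fun f g => by
      ext j
      rw [map_add, map_nsmul, map_nsmul]
      rfl
    refine ⟨N' • h + N • h', add_mem_torsionHilbertFunctions
      (nsmul_mem_torsionHilbertFunctions k hh N') (nsmul_mem_torsionHilbertFunctions k hh' N),
      N' * N, mul_pos hN' hN, ?_, ?_⟩
    · rw [cast_eq, mk_add, add_mul, smul_mul_assoc, smul_mul_assoc]
      exact add_mem (nsmul_mem hp _) (nsmul_mem hp' _)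
    · rw [cast_eq, map_add, map_nsmul, map_nsmul, mk_add, hT, hT', smul_add, smul_smul, smul_smul,
        mul_comm N N']

end Realization

end HilbertCone

theorem theorem2 (k : Type u) [Field k] (n : ℕ) (a : ℤ) (ha : -(n : ℤ) ≤ a) :
    HilbertCone.T n '' HilbertCone.Q k n a = HilbertCone.P n a := by
  refine HilbertCone.image_closedConvexHullIn
    (HilbertCone.torsionHilbertFunctions_subset
      (HilbertCone.zero_mem_torsionHilbertFunctions k n))
    (fun h hh => HilbertCone.exists_T_eq_natCast hh) fun g hg => ?_
  obtain ⟨b, -, hgb⟩ := id hg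
  obtain ⟨h, hh, N, hN, hp, hT⟩ := HilbertCone.exists_T_eq_smul_of_mem_binomialCone k
    (HilbertCone.mk_mem_binomialCone n g (HilbertCone.mem_polynomialSubring.2 ⟨b, hgb⟩))
  have hT' : HilbertCone.T n (fun j => (h j : ℚ)) = N • fun j => (g j : ℚ) := by
    funext j
    have := congrArg (PowerSeries.coeff j) hT
    rwa [map_nsmul, PowerSeries.coeff_mk, PowerSeries.coeff_mk] at this
  obtain ⟨c, hc⟩ := HilbertCone.mem_polynomialSubring.1 hp
  exact ⟨h, HilbertCone.torsionHilbertFunctions_subset hh, N, hN,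
    HilbertCone.mem_V_of_T_mem_V hc (hT' ▸ nsmul_mem hg N), hT'⟩
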